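/- Call a subset of $\mathbb{R}^2$ a polygon if it is a non-empty finite union of convex hulls of finite sets, each having non-empty interior. A polygonal partition of a polygon $X$ is a finite family of polygons (its atoms) with union $X$ and pairwise disjoint interiors. A Euclidean polygon exchange consists of a polygon $X\subset\mathbb{R}^2$, a polygonal partition $\mathcal{P}=\{P_1,\dots,P_r\}$ of $X$, and Euclidean isometries $g_1,\dots,g_r$ of $\mathbb{R}^2$ such that $g_1(P_1),\dots,g_r(P_r)$ is again a polygonal partition of $X$; the map $T$ is defined by $T(x)=g_i(x)$ for $x\in\operatorname{int}P_i$. A polygonal partition $\mathcal{U}$ of $X$ refines $\mathcal{P}$ if every atom of $\mathcal{U}$ is contained in an atom of $\mathcal{P}$. For such $\mathcal{U}$ and $n\ge 1$, let $\mathcal{U}_n=\bigvee_{k=0}^{n-1}T^{-k}\mathcal{U}$ be the $n$-th join: its atoms are the closures of the non-empty sets among $\{x: T^k x\in \operatorname{int}U_{k}\text{ for }0\le k<n\}$, where $U_0,\dots,U_{n-1}$ are atoms of $\mathcal{U}$. Let $|\mathcal{U}_n|$ be the number of atoms of $\mathcal{U}_n$, and define the topological entropy of $T$ by $$h(T)=\sup_{\mathcal{U}}\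 \limsup_{n\to\infty}\frac1n\log|\mathcal{U}_n|,$$ the supremum being over all polygonal partitions $\mathcal{U}$ of $X$ that refine $\mathcal{P}$. **Theorem 7.** For every Euclidean polygon exchange, $h(T)=0$. Moreover, the length of the boundary of $\mathcal{P}_n$ grows at most linearly: there is a constant $C<\infty$, depending on the exchange, such that for all $n\ge1$ the one-dimensional Hausdorff measure of $\bigcup_{A\in\mathcal{P}_n}\partial A$ is at most $Cn$. -/

import Mathlib

open MeasureTheory Set Filter
open scoped ENNReal NNReal

/-- The Euclidean plane. -/
abbrev Plane : Type := EuclideanSpace ℝ (Fin 2)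

/-- A polygon: a compact two-dimensional polyhedron in the plane, i.e. a non-empty finite union of
convex hulls of finite sets, each with non-empty interior. It need be neither convex nor simply
connected nor connected. -/
def IsPolygon (A : Set Plane) : Prop :=
  ∃ F : Finset (Finset Plane), F.Nonempty ∧
    (∀ s ∈ F, (interior (convexHull ℝ (s : Set Plane))).Nonempty) ∧
    A = ⋃ s ∈ F, convexHull ℝ (s : Set Plane)

/-- A finite family of polygons with union `X` and pairwise disjoint interiors. -/
structure IsPolygonalPartition {m : ℕ} (X : Set Plane) (U : Fin m → Set Plane) : Prop where
  isPolygon : ∀ j, IsPolygon (U j)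
  iUnion_eq : ⋃ j, U j = X
  disjoint_interior : ∀ i j, i ≠ j → Disjoint (interior (U i)) (interior (U j))

/-- `U` is a refinement of `P`: every atom of `U` lies in an atom of `P`. -/
def Refines {m r : ℕ} (U : Fin m → Set Plane) (P : Fin r → Set Plane) : Prop :=
  ∀ j, ∃ i, U j ⊆ P i

/-- The length of the boundary of a partition with set of atoms `𝒜`: the one-dimensional Hausdorff
measure of the union of the boundaries of the atoms. -/
noncomputable def boundaryLength (𝒜 : Set (Set Plane)) : ℝ≥0∞ :=
  μH[1] (⋃ A ∈ 𝒜, frontier A)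

/-- A Euclidean polygon exchange: a polygon `X`, a polygonal partition `P` of `X`, and isometries
`g i` of the plane such that the polygons `g i (P i)` also form a partition of `X`. -/
structure EuclideanPolygonExchange where
  /-- the polygon -/
  X : Set Plane
  isPolygon : IsPolygon X
  /-- the number of atoms -/
  r : ℕ
  /-- the atoms of the defining partition -/
  P : Fin r → Set Plane
  partition : IsPolygonalPartition X P
  /-- the isometries that move the atoms -/
  g : Fin r → Plane ≃ᵢ Plane
  image_partition : IsPolygonalPartition X (fun i => g i '' P i)

namespace EuclideanPolygonExchange

/-- The preimage `T⁻¹ A` under the exchange transformation `T`, which is given by `T x = g i x` for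
`x` in the interior of the atom `P i` (on the boundaries of the atoms `T` is not single-valued).
The preimage `T⁻ᵏ A` is the iterate `(E.preimage)^[k] A`. -/
def preimage (E : EuclideanPolygonExchange) (A : Set Plane) : Set Plane :=
  {x | ∃ i, x ∈ interior (E.P i) ∧ E.g i x ∈ A}

/-- For a word `w` of length `n`, the set of the points `x` such that `T^k x` lies in the interior
of the atom `U (w k)` for all `k < n`. -/
def cylinder (E : EuclideanPolygonExchange) {m : ℕ} (U : Fin m → Set Plane) {n : ℕ}
    (w : Fin n → Fin m) : Set Plane :=
  ⋂ k : Fin n, E.preimage^[(k : ℕ)] (interior (U (w k)))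

/-- The set of atoms of the `n`-th join `U ∨ T⁻¹ U ∨ ⋯ ∨ T^{-(n-1)} U` (`n ≥ 1`): the intersections
`U (w 0) ∩ T⁻¹ (U (w 1)) ∩ ⋯` that have non-empty interior, each taken as the closure of
its interior (so that pieces of lower dimension are dropped). -/
def join (E : EuclideanPolygonExchange) {m : ℕ} (U : Fin m → Set Plane) (n : ℕ) :
    Set (Set Plane) :=
  {A | ∃ w : Fin n → Fin m, (E.cylinder U w).Nonempty ∧ A = closure (E.cylinder U w)}

/-- The entropy relative to `U`: the upper limit of `(1 / n) * log |U_n|`, where `|U_n|` is the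
number of atoms of the `n`-th join. -/
noncomputable def entropyRel (E : EuclideanPolygonExchange) {m : ℕ} (U : Fin m → Set Plane) :
    EReal :=
  limsup (fun n : ℕ => ENNReal.log (((E.join U n).encard : ℕ∞) : ℝ≥0∞) / (n : EReal)) atTop

/-- The topological entropy: the supremum of the relative entropies over all polygonal partitions
of `X` that refine the defining partition. -/
noncomputable def topologicalEntropy (E : EuclideanPolygonExchange) : EReal :=
  ⨆ (m : ℕ) (U : Fin m → Set Plane) (_ : IsPolygonalPartition E.X U) (_ : Refines U E.P),
    E.entropyRel U

end EuclideanPolygonExchange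

/-! Entropy vanishes because isometries preserve both balls and the aperture of cones, so local
counts of itineraries multiply. Here `words n F` collects the itineraries of length `n` whose open
cylinders are met frequently along a filter `F`. If a class of filters is stable under refinement
and isometries and each of its members sees at most `c` words of length `N`, then each sees `O(c ^
(n / N))` words of length `n` (`exists_card_words_le`). This is applied twice.

Fix `K`. The cylinders of length `K` have boundaries on finitely many lines, hence in finitely many
directions. Near its apex, a narrow enough cone meets at most one line direction, which cuts it into
two convex halves, so it sees at most 2 words. Thus every narrow cone sees `O(2 ^ (n / K))` words,
and, as finitely many cones surround a point, so does every point, with a factor `D` uniform in the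
point.

Fix `N`. By compactness every ball of some fixed radius meets at most `D * 2 ^ (N / K)` cylinders of
length `N`. The total count is then `O((D * 2 ^ (N / K)) ^ (n / N))`, of exponential rate at most
`(log D) / N + (log 2) / K`. Large `K`, then large `N`, make this arbitrarily small.

For the boundary length, the boundary at stage `n + 1` consists of boundaries of atoms and of pieces
of the stage `n` boundary pulled back by isometries from the essentially disjoint sets `g i '' P i`.
Each stage therefore adds at most a constant. -/

open scoped Topology

/-! ### Polygon boundaries and finite families of lines -/

/-- A set is covered by finitely many lines, each given as the zero set of a non-constant affine
function. -/
def CoveredByLines (S : Set Plane) : Prop :=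
  ∃ T : Finset (Plane →ᵃ[ℝ] ℝ), (∀ f ∈ T, f.linear ≠ 0) ∧ ∀ x ∈ S, ∃ f ∈ T, f x = 0

namespace CoveredByLines

theorem mono {S S' : Set Plane} (h : CoveredByLines S) (hS : S' ⊆ S) : CoveredByLines S' := by
  obtain ⟨T, hT, h⟩ := h
  exact ⟨T, hT, fun x hx => h x (hS hx)⟩

theorem empty : CoveredByLines ∅ := ⟨∅, by simp, by simp⟩

theorem iUnion {ι : Type*} [Finite ι] {S : ι → Set Plane} (h : ∀ i, CoveredByLines (S i)) :
    CoveredByLines (⋃ i, S i) := by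
  classical
  cases nonempty_fintype ι
  choose T hT hS using h
  refine ⟨Finset.univ.biUnion T, ?_, ?_⟩
  · simp only [Finset.mem_biUnion]
    rintro f ⟨i, -, hf⟩
    exact hT i f hf
  · intro x hx
    obtain ⟨i, hi⟩ := mem_iUnion.1 hx
    obtain ⟨f, hf, hfx⟩ := hS i x hi
    exact ⟨f, Finset.mem_biUnion.2 ⟨i, Finset.mem_univ _, hf⟩, hfx⟩

theorem union {S S' : Set Plane} (h : CoveredByLines S) (h' : CoveredByLines S') :
    CoveredByLines (S ∪ S') := by
  rw [union_eq_iUnion]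
  exact iUnion (by rintro (_ | _) <;> assumption)

theorem preimage {S : Set Plane} (h : CoveredByLines S) (e : Plane ≃ᵢ Plane) :
    CoveredByLines (e ⁻¹' S) := by
  classical
  obtain ⟨T, hT, h⟩ := h
  let a : Plane ≃ᵃⁱ[ℝ] Plane := e.toRealAffineIsometryEquiv
  have ha : ∀ x, a x = e x := fun x => by simp [a]
  refine ⟨T.image fun f => f.comp (a.toAffineEquiv : Plane →ᵃ[ℝ] Plane), ?_, ?_⟩
  · simp only [Finset.mem_image]
    rintro _ ⟨f, hf, rfl⟩ h0
    refine hT f hf (LinearMap.ext fun v => ?_)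
    have := LinearMap.congr_fun h0 (a.linearIsometryEquiv.symm v)
    simpa using this
  · intro x hx
    obtain ⟨f, hf, hfx⟩ := h _ hx
    refine ⟨_, Finset.mem_image_of_mem _ hf, ?_⟩
    simpa [ha] using hfx

end CoveredByLines

/-- In the plane the kernel of a non-zero linear functional is spanned by any of its non-zero
elements. -/
theorem exists_smul_eq_of_mem_ker {φ : Plane →ₗ[ℝ] ℝ} (hφ : φ ≠ 0) {u v : Plane} (hv : v ≠ 0)
    (hφv : φ v = 0) (hφu : φ u = 0) : ∃ c : ℝ, c • v = u := by
  have h1 : Module.finrank ℝ (LinearMap.ker φ) = 1 := by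
    have := Module.Dual.finrank_ker_add_one_of_ne_zero (f := φ) hφ
    simp at this
    exact this
  have hv' : (⟨v, hφv⟩ : LinearMap.ker φ) ≠ 0 := fun h => hv (congrArg Subtype.val h)
  obtain ⟨c, hc⟩ := (finrank_eq_one_iff_of_nonzero' _ hv').1 h1 ⟨u, hφu⟩
  exact ⟨c, congrArg Subtype.val hc⟩

theorem exists_ne_zero_mem_ker (φ : Plane →ₗ[ℝ] ℝ) : ∃ v : Plane, v ≠ 0 ∧ φ v = 0 := by
  have h : LinearMap.ker φ ≠ ⊥ := LinearMap.ker_ne_bot_of_finrank_lt (by simp)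
  obtain ⟨v, hv, hv0⟩ := Submodule.exists_mem_ne_zero_of_ne_bot h
  exact ⟨v, hv0, hv⟩

/-- The affine function vanishing on the line through `a` in direction `v`. -/
noncomputable def lineFunction (a v : Plane) : Plane →ᵃ[ℝ] ℝ :=
  ((v 1 • (EuclideanSpace.proj (𝕜 := ℝ) (0 : Fin 2) : Plane →L[ℝ] ℝ).toLinearMap -
      v 0 • (EuclideanSpace.proj (𝕜 := ℝ) (1 : Fin 2) : Plane →L[ℝ] ℝ).toLinearMap).toAffineMap).comp
    (AffineEquiv.vaddConst ℝ a).symm.toAffineMap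

theorem lineFunction_apply (a v x : Plane) :
    lineFunction a v x = v 1 * (x 0 - a 0) - v 0 * (x 1 - a 1) := by
  simp [lineFunction]

theorem lineFunction_linear_ne_zero (a : Plane) {v : Plane} (hv : v ≠ 0) :
    (lineFunction a v).linear ≠ 0 := by
  intro h
  apply hv
  have key : ∀ x, lineFunction a v x = 0 := fun x => by
    have h1 := (lineFunction a v).map_vadd a (x - a)
    rw [h] at h1
    simpa [lineFunction_apply] using h1
  have h0 := key (a + EuclideanSpace.single 0 1)
  have h1 := key (a + EuclideanSpace.single 1 1)
  rw [lineFunction_apply] at h0 h1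
  ext i
  fin_cases i
  · simpa using h1
  · simpa using h0

/-- The boundary of a convex polygon lies on the lines through pairs of its generating points. -/
theorem coveredByLines_frontier_convexHull {s : Finset Plane}
    (hs : (interior (convexHull ℝ (s : Set Plane))).Nonempty) :
    CoveredByLines (frontier (convexHull ℝ (s : Set Plane))) := by
  classical
  refine ⟨(s.offDiag).image fun q => lineFunction q.1 (q.2 - q.1), ?_, ?_⟩
  · simp only [Finset.mem_image, Finset.mem_offDiag]
    rintro _ ⟨⟨a, b⟩, ⟨-, -, hab⟩, rfl⟩
    exact lineFunction_linear_ne_zero _ (sub_ne_zero.2 (Ne.symm hab))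
  · intro x hx
    have hcl : IsClosed (convexHull ℝ (s : Set Plane)) :=
      s.finite_toSet.isClosed_convexHull ℝ
    have hconv := convex_convexHull ℝ (s : Set Plane)
    -- A supporting functional at `x`: only generators on its face can carry weight in a convex
    -- combination equal to `x`. Two generators on the face span the line sought; otherwise `x` is
    -- itself a generator.
    obtain ⟨f, hf⟩ := geometric_hahn_banach_open_point hconv.interior isOpen_interior hx.2
    have hf0 : (f : Plane →ₗ[ℝ] ℝ) ≠ 0 := by
      rintro h0
      obtain ⟨z, hz⟩ := hs
      have h1 : f z = 0 := LinearMap.congr_fun h0 z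
      have h2 : f x = 0 := LinearMap.congr_fun h0 x
      have := hf z hz
      rw [h1, h2] at this
      exact lt_irrefl _ this
    have hfle : ∀ z ∈ s, f z ≤ f x := by
      have hsub : closure (interior (convexHull ℝ (s : Set Plane))) ⊆ {z | f z ≤ f x} :=
        closure_minimal (fun z hz => (hf z hz).le) (isClosed_le f.continuous continuous_const)
      intro z hz
      apply hsub
      rw [hconv.closure_interior_eq_closure_of_nonempty_interior hs]
      exact subset_closure (subset_convexHull ℝ _ hz)
    have hxs : x ∈ convexHull ℝ (s : Set Plane) := hcl.frontier_subset hx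
    obtain ⟨w, hw0, hw1, hwx⟩ := Finset.mem_convexHull'.1 hxs
    have hw : ∀ z ∈ s, f z ≠ f x → w z = 0 := by
      have hsum : ∑ z ∈ s, w z * (f x - f z) = 0 := by
        have h1 : ∑ z ∈ s, w z * f z = f x := by
          rw [← hwx, map_sum]
          simp
        simp only [mul_sub, Finset.sum_sub_distrib, ← Finset.sum_mul, hw1, h1]
        ring
      have := (Finset.sum_eq_zero_iff_of_nonneg fun z hz =>
        mul_nonneg (hw0 z hz) (sub_nonneg.2 (hfle z hz))).1 hsum
      intro z hz hne
      rcases mul_eq_zero.1 (this z hz) with h | h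
      · exact h
      · exact absurd (sub_eq_zero.1 h).symm hne
    obtain ⟨a, ha, hwa⟩ : ∃ a ∈ s, w a ≠ 0 := by
      by_contra! h
      rw [Finset.sum_eq_zero h] at hw1
      exact zero_ne_one hw1
    have hfa : f a = f x := by_contra fun h => hwa (hw a ha h)
    by_cases hb : ∃ b ∈ s, b ≠ a ∧ f b = f x
    · obtain ⟨b, hbs, hba, hfb⟩ := hb
      refine ⟨_, Finset.mem_image_of_mem _ (show (a, b) ∈ s.offDiag from
        Finset.mem_offDiag.2 ⟨ha, hbs, hba.symm⟩), ?_⟩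
      obtain ⟨c, hc⟩ := exists_smul_eq_of_mem_ker hf0 (u := x - a) (v := b - a)
        (sub_ne_zero.2 hba) (by simp [hfa, hfb]) (by simp [hfa])
      have hx' : x = a + c • (b - a) := by rw [hc]; abel
      rw [hx', lineFunction_apply]
      simp
      ring
    · push Not at hb
      have hxa : x = a := by
        have hz : ∀ z ∈ s, z ≠ a → w z = 0 := fun z hz hza => hw z hz (hb z hz hza)
        have e1 : w a = 1 := by
          rw [← hw1]; exact (Finset.sum_eq_single_of_mem a ha fun z hz' hne => hz z hz' hne).symm
        rw [← hwx, Finset.sum_eq_single_of_mem a ha fun z hz' hne => by rw [hz z hz' hne, zero_smul],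
          e1, one_smul]
      obtain ⟨b, hbs, hba⟩ : ∃ b ∈ s, b ≠ a := by
        by_contra! h
        have : (s : Set Plane) = {a} := by
          ext z
          simp only [Finset.mem_coe, mem_singleton_iff]
          exact ⟨h z, fun hz => hz ▸ ha⟩
        rw [this, convexHull_singleton, interior_singleton] at hs
        exact hs.ne_empty rfl
      refine ⟨_, Finset.mem_image_of_mem _ (show (a, b) ∈ s.offDiag from
        Finset.mem_offDiag.2 ⟨ha, hbs, hba.symm⟩), ?_⟩
      simp [hxa, lineFunction_apply]

theorem frontier_biUnion_finset_subset {α β : Type*} [TopologicalSpace β] (F : Finset α)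
    (S : α → Set β) : frontier (⋃ a ∈ F, S a) ⊆ ⋃ a ∈ F, frontier (S a) := by
  rintro x ⟨hx, hx'⟩
  rw [Finset.closure_biUnion] at hx
  simp only [mem_iUnion] at hx ⊢
  obtain ⟨a, ha, hxa⟩ := hx
  exact ⟨a, ha, hxa, fun h => hx' (interior_mono (subset_biUnion_of_mem (u := S) ha) h)⟩

namespace IsPolygon

variable {A : Set Plane}

theorem isCompact (hA : IsPolygon A) : IsCompact A := by
  obtain ⟨F, -, -, rfl⟩ := hA
  exact F.isCompact_biUnion fun s _ => s.finite_toSet.isCompact_convexHull ℝ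

theorem interior_nonempty (hA : IsPolygon A) : (interior A).Nonempty := by
  obtain ⟨F, ⟨s, hs⟩, hF, rfl⟩ := hA
  exact (hF s hs).mono
    (interior_mono (subset_biUnion_of_mem (u := fun s : Finset Plane => convexHull ℝ (s : Set Plane)) hs))

theorem coveredByLines_frontier (hA : IsPolygon A) : CoveredByLines (frontier A) := by
  obtain ⟨F, -, hF, rfl⟩ := hA
  refine CoveredByLines.mono ?_ (frontier_biUnion_finset_subset F _)
  have := CoveredByLines.iUnion (ι := F)
    (S := fun s => frontier (convexHull ℝ ((s : Finset Plane) : Set Plane)))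
    fun s => coveredByLines_frontier_convexHull (hF s s.2)
  refine this.mono ?_
  simp only [iUnion_subset_iff]
  intro s hs
  exact subset_iUnion (fun s : F => frontier (convexHull ℝ ((s : Finset Plane) : Set Plane))) ⟨s, hs⟩

end IsPolygon

/-- A bounded set covered by finitely many lines has finite length. -/
theorem CoveredByLines.hausdorffMeasure_lt_top {S : Set Plane} (hS : CoveredByLines S)
    (hb : Bornology.IsBounded S) : μH[1] S < ∞ := by
  obtain ⟨T, hT, h⟩ := hS
  have hsub : S ⊆ ⋃ f ∈ T, (S ∩ {x | f x = 0}) := fun x hx => by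
    obtain ⟨f, hf, hfx⟩ := h x hx
    exact mem_biUnion hf ⟨hx, hfx⟩
  refine (measure_mono hsub).trans_lt ((measure_biUnion_lt_top T.finite_toSet fun f hf => ?_))
  obtain ⟨v, hv0, hv⟩ := exists_ne_zero_mem_ker f.linear
  rcases (S ∩ {x | f x = 0}).eq_empty_or_nonempty with he | ⟨p, hpS, hp⟩
  · simp [he]
  obtain ⟨R, hR⟩ := hb.subset_closedBall p
  let γ : ℝ → Plane := fun t => p + t • v
  have hγ : LipschitzWith ‖v‖₊ γ := LipschitzWith.of_dist_le_mul fun s t => by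
    simp only [γ]
    rw [dist_add_left, dist_eq_norm, dist_eq_norm, ← sub_smul, norm_smul, coe_nnnorm, mul_comm]
  have hsub : S ∩ {x | f x = 0} ⊆ γ '' Icc (-(R / ‖v‖)) (R / ‖v‖) := by
    rintro x ⟨hxS, hx⟩
    have hlin : f.linear (x - p) = 0 := by
      have := f.linearMap_vsub x p
      simp only [vsub_eq_sub] at this
      rw [this]
      rw [show f x = 0 from hx, show f p = 0 from hp, sub_zero]
    obtain ⟨c, hc⟩ := exists_smul_eq_of_mem_ker (hT f hf) hv0 hv hlin
    refine ⟨c, ?_, by simp [γ, hc]⟩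
    have hx' := hR hxS
    rw [Metric.mem_closedBall, dist_eq_norm, ← hc, norm_smul] at hx'
    rw [mem_Icc, ← abs_le, le_div_iff₀ (norm_pos_iff.2 hv0)]
    exact hx'
  refine (measure_mono hsub).trans_lt ((hγ.hausdorffMeasure_image_le zero_le_one _).trans_lt ?_)
  rw [hausdorffMeasure_real]
  simp [ENNReal.mul_lt_top_iff]

/-! ### Itineraries counted along filters -/

/-- A piecewise isometric system in the plane: finitely many disjoint bounded open pieces with
boundaries on finitely many lines, each moved by an isometry. -/
structure PieceSystem (ι : Type*) where
  /-- the pieces -/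
  piece : ι → Set Plane
  /-- the isometries that move the pieces -/
  move : ι → Plane ≃ᵢ Plane
  isOpen : ∀ j, IsOpen (piece j)
  isBounded : ∀ j, Bornology.IsBounded (piece j)
  disjoint : ∀ i j, i ≠ j → Disjoint (piece i) (piece j)
  coveredByLines : ∀ j, CoveredByLines (frontier (piece j))

namespace PieceSystem

variable {ι : Type*} (S : PieceSystem ι)

/-- The points whose itinerary begins with a given word. -/
def cyl : List ι → Set Plane
  | [] => univ
  | j :: w => S.piece j ∩ S.move j ⁻¹' cyl w

/-- The isometry by which the points of a cylinder are moved. -/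
noncomputable def act : List ι → Plane ≃ᵢ Plane
  | [] => IsometryEquiv.refl _
  | j :: w => (S.move j).trans (act w)

theorem cyl_append (u v : List ι) : S.cyl (u ++ v) = S.cyl u ∩ S.act u ⁻¹' S.cyl v := by
  induction u with
  | nil =>
    ext x
    simp only [List.nil_append, cyl, univ_inter]
    rfl
  | cons j u ih =>
    ext x
    simp [cyl, act, ih, and_assoc]

theorem isOpen_cyl (w : List ι) : IsOpen (S.cyl w) := by
  induction w with
  | nil => exact isOpen_univ
  | cons j w ih => exact (S.isOpen j).inter (ih.preimage (S.move j).continuous)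

theorem disjoint_cyl {u w : List ι} (hl : u.length = w.length) (hne : u ≠ w) :
    Disjoint (S.cyl u) (S.cyl w) := by
  induction u generalizing w with
  | nil => exact absurd (List.length_eq_zero_iff.1 hl.symm).symm hne
  | cons i u ih =>
    cases w with
    | nil => simp at hl
    | cons j w =>
      rw [Set.disjoint_left]
      rintro x ⟨hxi, hxu⟩ ⟨hxj, hxw⟩
      by_cases hij : i = j
      · subst hij
        exact Set.disjoint_left.1 (ih (by simpa using hl) (fun h => hne (by rw [h]))) hxu hxw
      · exact Set.disjoint_left.1 (S.disjoint i j hij) hxi hxj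

theorem frontier_cyl_cons_subset (j : ι) (w : List ι) :
    frontier (S.cyl (j :: w)) ⊆
      frontier (S.piece j) ∪ closure (S.piece j) ∩ S.move j ⁻¹' frontier (S.cyl w) := by
  refine (frontier_inter_subset _ _).trans (union_subset_union inter_subset_left ?_)
  rw [← (S.move j).coe_toHomeomorph, ← (S.move j).toHomeomorph.preimage_frontier]

theorem coveredByLines_frontier_cyl (w : List ι) : CoveredByLines (frontier (S.cyl w)) := by
  induction w with
  | nil => simpa [cyl] using CoveredByLines.empty
  | cons j w ih =>
    exact ((S.coveredByLines j).union ((ih.preimage (S.move j)).mono inter_subset_right)).mono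
      (S.frontier_cyl_cons_subset j w)

variable [Finite ι]

open Classical in
/-- The words of length `n` whose cylinders accumulate along the filter `F`. -/
noncomputable def words (n : ℕ) (F : Filter Plane) : Finset (List ι) :=
  (List.finite_length_eq ι n).toFinset.filter fun w => ∃ᶠ x in F, x ∈ S.cyl w

theorem mem_words {n : ℕ} {F : Filter Plane} {w : List ι} :
    w ∈ S.words n F ↔ w.length = n ∧ ∃ᶠ x in F, x ∈ S.cyl w := by
  simp [words]

theorem words_mono {n : ℕ} {F G : Filter Plane} (h : F ≤ G) : S.words n F ⊆ S.words n G := by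
  intro w hw
  rw [mem_words] at hw ⊢
  exact ⟨hw.1, hw.2.filter_mono h⟩

/-- A family of filters that is downward closed and invariant under isometries. -/
structure IsInvariantFamily (𝒞 : Set (Filter Plane)) : Prop where
  mono : ∀ F G, F ≤ G → G ∈ 𝒞 → F ∈ 𝒞
  map : ∀ F ∈ 𝒞, ∀ e : Plane ≃ᵢ Plane, F.map e ∈ 𝒞

/-- If `F` sees `u ++ v`, then `v` is seen by the image under `act u` of `F` restricted to `cyl u`.
This filter is again in the family, so each `u` has at most `c` continuations. -/
theorem card_words_add_le {𝒞 : Set (Filter Plane)} (h𝒞 : IsInvariantFamily 𝒞) {a b c : ℕ}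
    (hb : ∀ F ∈ 𝒞, (S.words b F).card ≤ c) {F : Filter Plane} (hF : F ∈ 𝒞) :
    (S.words (a + b) F).card ≤ (S.words a F).card * c := by
  classical
  have hsub : S.words (a + b) F ⊆ (S.words a F).biUnion fun u =>
      (S.words b ((F ⊓ 𝓟 (S.cyl u)).map (S.act u))).image (u ++ ·) := by
    intro w hw
    rw [mem_words] at hw
    obtain ⟨hl, hw⟩ := hw
    have hfreq := hw
    rw [← List.take_append_drop a w, cyl_append] at hfreq
    refine Finset.mem_biUnion.2 ⟨w.take a, ?_, Finset.mem_image.2 ⟨w.drop a, ?_,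
      List.take_append_drop a w⟩⟩
    · exact S.mem_words.2 ⟨by simp [hl], hfreq.mono fun x hx => hx.1⟩
    · refine S.mem_words.2 ⟨by simp [hl], ?_⟩
      rw [frequently_map, frequently_inf_principal]
      exact hfreq
  refine (Finset.card_le_card hsub).trans (Finset.card_biUnion_le_card_mul _ _ _ fun u _ => ?_)
  exact Finset.card_image_le.trans
    (hb _ (h𝒞.map _ (h𝒞.mono _ _ inf_le_left hF) _))

theorem card_words_mul_le {𝒞 : Set (Filter Plane)} (h𝒞 : IsInvariantFamily 𝒞) {N c : ℕ}
    (hN : ∀ F ∈ 𝒞, (S.words N F).card ≤ c) (k : ℕ) :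
    ∀ F ∈ 𝒞, (S.words (k * N) F).card ≤ c ^ k := by
  induction k with
  | zero =>
    intro F hF
    rw [pow_zero, zero_mul]
    refine Finset.card_le_one.2 fun u hu v hv => ?_
    rw [List.length_eq_zero_iff.1 (S.mem_words.1 hu).1,
      List.length_eq_zero_iff.1 (S.mem_words.1 hv).1]
  | succ k ih =>
    intro F hF
    rw [add_mul, one_mul, pow_succ]
    exact (S.card_words_add_le h𝒞 hN hF).trans (Nat.mul_le_mul_right _ (ih F hF))

/-- If the filters of an invariant family see at most `c` words of length `N`, then the numbers of
words of length `n` that they see are of order at most `c ^ (n / N)`. -/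
theorem exists_card_words_le {𝒞 : Set (Filter Plane)} (h𝒞 : IsInvariantFamily 𝒞) {N c : ℕ}
    (hN0 : 0 < N) (hN : ∀ F ∈ 𝒞, (S.words N F).card ≤ c) :
    ∃ B : ℕ, ∀ n, ∀ F ∈ 𝒞, (S.words n F).card ≤ B * c ^ (n / N) := by
  -- The constant absorbs the remainder `n % N`, whatever it is.
  refine ⟨∑ r ∈ Finset.range N, (S.words r ⊤).card, fun n F hF => ?_⟩
  have hn : n / N * N + n % N = n := Nat.div_add_mod' n N
  have h1 : ∀ G ∈ 𝒞, (S.words (n % N) G).card ≤ ∑ r ∈ Finset.range N, (S.words r ⊤).card :=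
    fun G _ => (Finset.card_le_card (S.words_mono le_top)).trans
      (Finset.single_le_sum (f := fun r => (S.words r ⊤).card) (fun _ _ => Nat.zero_le _)
        (Finset.mem_range.2 (Nat.mod_lt n hN0)))
  calc (S.words n F).card = (S.words (n / N * N + n % N) F).card := by rw [hn]
    _ ≤ (S.words (n / N * N) F).card * _ := S.card_words_add_le h𝒞 h1 hF
    _ ≤ c ^ (n / N) * _ := Nat.mul_le_mul_right _ (S.card_words_mul_le h𝒞 hN _ F hF)
    _ = _ := mul_comm _ _

/-- The words seen by a filter covered by finitely many others. -/
theorem card_words_le_sum {α : Type*} (s : Finset α) (G : α → Filter Plane) {n c : ℕ}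
    {F : Filter Plane} (hF : ∀ w : List ι, w.length = n → (∃ᶠ x in F, x ∈ S.cyl w) →
      ∃ a ∈ s, ∃ᶠ x in G a, x ∈ S.cyl w)
    (hc : ∀ a ∈ s, (S.words n (G a)).card ≤ c) : (S.words n F).card ≤ s.card * c := by
  classical
  refine (Finset.card_le_card (t := s.biUnion fun a => S.words n (G a)) fun w hw => ?_).trans
    (Finset.card_biUnion_le_card_mul _ _ _ hc)
  obtain ⟨hl, hw⟩ := S.mem_words.1 hw
  obtain ⟨a, ha, h⟩ := hF w hl hw
  exact Finset.mem_biUnion.2 ⟨a, ha, S.mem_words.2 ⟨hl, h⟩⟩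

/-- If at every point at most `c` cylinders of length `N` meet, then the total number of words of
length `n` is of order at most `c ^ (n / N)`. -/
theorem exists_card_words_top_le {N c : ℕ} (hN0 : 0 < N)
    (hc : ∀ y, (S.words N (𝓝 y)).card ≤ c) :
    ∃ B : ℕ, ∀ n, (S.words n ⊤).card ≤ B * c ^ (n / N) := by
  classical
  obtain ⟨X, hX, hpX⟩ : ∃ X : Set Plane, IsCompact X ∧ ∀ j, S.piece j ⊆ X :=
    ⟨closure (⋃ j, S.piece j), ((Bornology.isBounded_iUnion).2 S.isBounded).isCompact_closure,
      fun j => (subset_iUnion _ j).trans subset_closure⟩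
  have hcylX : ∀ w : List ι, w ≠ [] → S.cyl w ⊆ X := by
    rintro (_ | ⟨j, w⟩) hw
    · exact absurd rfl hw
    · exact inter_subset_left.trans (hpX j)
  have hV : ∀ y, ∃ V, IsOpen V ∧ y ∈ V ∧ (S.words N (𝓟 V)).card ≤ c := by
    intro y
    -- Only finitely many words are not seen at `y`, so one neighbourhood avoids all their
    -- cylinders.
    have : ∀ᶠ x in 𝓝 y, ∀ w ∈ (List.finite_length_eq ι N).toFinset \ S.words N (𝓝 y),
        x ∉ S.cyl w := by
      rw [Filter.eventually_all_finset]
      intro w hw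
      rw [Finset.mem_sdiff, mem_words] at hw
      by_contra h
      exact hw.2 ⟨by simpa using hw.1, h⟩
    obtain ⟨V, hV, hVo, hyV⟩ := mem_nhds_iff.1 this
    refine ⟨V, hVo, hyV, (Finset.card_le_card fun w hw => ?_).trans (hc y)⟩
    by_contra hwn
    obtain ⟨hl, hw⟩ := S.mem_words.1 hw
    obtain ⟨x, hxV, hxw⟩ := frequently_principal.1 hw
    exact hV hxV w (Finset.mem_sdiff.2 ⟨by simpa using hl, hwn⟩) hxw
  choose V hVo hyV hVc using hV
  obtain ⟨δ, hδ, hball⟩ := lebesgue_number_lemma_of_metric (c := V) hX hVo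
    fun y _ => mem_iUnion.2 ⟨y, hyV y⟩
  -- With radius `δ / 2`, a ball that meets `X` at `a` lies in the `δ`-ball about `a`, hence in some
  -- `V i`. A ball that misses `X` sees no non-empty word.
  let 𝒞 : Set (Filter Plane) := {F | ∃ x, F ≤ 𝓟 (Metric.ball x (δ / 2))}
  have h𝒞 : IsInvariantFamily 𝒞 := by
    constructor
    · rintro F G hFG ⟨x, hx⟩
      exact ⟨x, hFG.trans hx⟩
    · rintro F ⟨x, hx⟩ e
      refine ⟨e x, (map_mono hx).trans ?_⟩
      rw [map_principal, e.image_ball]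
  have hN : ∀ F ∈ 𝒞, (S.words N F).card ≤ c := by
    rintro F ⟨x, hx⟩
    by_cases hxX : ∃ a ∈ Metric.ball x (δ / 2), a ∈ X
    · obtain ⟨a, hax, haX⟩ := hxX
      obtain ⟨i, hi⟩ := hball a haX
      refine (Finset.card_le_card (S.words_mono (hx.trans (principal_mono.2 ?_)))).trans (hVc i)
      refine Subset.trans ?_ hi
      apply Metric.ball_subset_ball'
      rw [Metric.mem_ball, dist_comm] at hax
      linarith
    · rw [Finset.card_eq_zero.2]
      · exact Nat.zero_le _
      refine Finset.eq_empty_of_forall_notMem fun w hw => ?_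
      obtain ⟨hl, hw⟩ := S.mem_words.1 hw
      obtain ⟨a, ha, haw⟩ := frequently_principal.1 (hw.filter_mono hx)
      refine hxX ⟨a, ha, hcylX w ?_ haw⟩
      rintro rfl
      simp at hl
      omega
  obtain ⟨B, hB⟩ := S.exists_card_words_le h𝒞 hN0 hN
  obtain ⟨t, -, ht⟩ := hX.elim_nhds_subcover (fun x => Metric.ball x (δ / 2))
    fun x _ => Metric.ball_mem_nhds x (half_pos hδ)
  -- The extra 1 serves `n = 0`: the cylinder of the empty word is the whole plane, which the balls
  -- covering `X` do not control.
  refine ⟨t.card * B + 1, fun n => ?_⟩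
  rcases Nat.eq_zero_or_pos n with rfl | hn
  · have : (S.words 0 ⊤).card ≤ 1 := Finset.card_le_one.2 fun u hu v hv => by
      rw [List.length_eq_zero_iff.1 (S.mem_words.1 hu).1,
        List.length_eq_zero_iff.1 (S.mem_words.1 hv).1]
    simp
    omega
  calc (S.words n ⊤).card ≤ t.card * (B * c ^ (n / N)) := by
        refine S.card_words_le_sum t (fun x => 𝓟 (Metric.ball x (δ / 2))) (fun w hl hw => ?_)
          fun x _ => hB n _ ⟨x, le_rfl⟩
        obtain ⟨x, hx⟩ := hw.exists
        obtain ⟨a, ha, hxa⟩ := mem_iUnion₂.1 (ht (hcylX w (by rintro rfl; simp at hl; omega) hx))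
        exact ⟨a, ha, frequently_principal.2 ⟨x, hxa, hx⟩⟩
    _ ≤ (t.card * B + 1) * c ^ (n / N) := by
        rw [← mul_assoc]
        exact Nat.mul_le_mul_right _ (Nat.le_succ _)

end PieceSystem

/-! ### Narrow cones -/

/-- The open circular cone with apex `y` around the direction `d`. -/
def openCone (y d : Plane) (ε : ℝ) : Set Plane :=
  {x | (1 - ε) * ‖x - y‖ < inner ℝ (x - y) d}

theorem isOpen_openCone (y d : Plane) (ε : ℝ) : IsOpen (openCone y d ε) :=
  isOpen_lt (by fun_prop) (by fun_prop)

theorem convex_openCone (y d : Plane) {ε : ℝ} (hε : ε ≤ 1) : Convex ℝ (openCone y d ε) := by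
  intro x hx z hz a b ha hb hab
  simp only [openCone, mem_ofPred_eq] at *
  have e : a • x + b • z - y = a • (x - y) + b • (z - y) := by
    rw [smul_sub, smul_sub]
    nth_rewrite 1 [← one_smul ℝ y]
    rw [← hab, add_smul]
    abel
  have h1 : ‖a • (x - y) + b • (z - y)‖ ≤ a * ‖x - y‖ + b * ‖z - y‖ := by
    refine (norm_add_le _ _).trans_eq ?_
    rw [norm_smul, norm_smul, Real.norm_of_nonneg ha, Real.norm_of_nonneg hb]
  rw [e, inner_add_left, real_inner_smul_left, real_inner_smul_left]
  have h2 := mul_le_mul_of_nonneg_left h1 (sub_nonneg.2 hε)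
  rcases ha.eq_or_lt with rfl | ha
  · have : b = 1 := by linarith
    subst this
    linarith
  · nlinarith [mul_lt_mul_of_pos_left hx ha, mul_le_mul_of_nonneg_left hz.le hb]

theorem ne_of_mem_openCone {x y d : Plane} {ε : ℝ} (hx : x ∈ openCone y d ε) : x - y ≠ 0 := by
  intro h
  simp [openCone, h] at hx

/-- For unit vectors, `‖u - d‖ ^ 2 = 2 - 2 * inner ℝ u d`, which is below `2 * ε` in the cone. -/
theorem norm_normalize_sub_lt {x y d : Plane} {ε ρ : ℝ} (hd : ‖d‖ = 1) (hρ : 0 < ρ)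
    (hε : 2 * ε ≤ ρ ^ 2) (hx : x ∈ openCone y d ε) : ‖‖x - y‖⁻¹ • (x - y) - d‖ < ρ := by
  have h0 : 0 < ‖x - y‖ := norm_pos_iff.2 (ne_of_mem_openCone hx)
  have h1 : ‖‖x - y‖⁻¹ • (x - y)‖ = 1 := by
    rw [norm_smul, norm_inv, norm_norm, inv_mul_cancel₀ h0.ne']
  have h2 : 1 - ε < inner ℝ (‖x - y‖⁻¹ • (x - y)) d := by
    rw [real_inner_smul_left, inv_mul_eq_div, lt_div_iff₀ h0]
    exact hx
  have h3 := norm_sub_sq_real (‖x - y‖⁻¹ • (x - y)) d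
  rw [h1, hd] at h3
  exact lt_of_pow_lt_pow_left₀ 2 hρ.le (by linarith)

theorem image_openCone_subset (e : Plane ≃ᵢ Plane) (y d : Plane) (ε : ℝ) :
    e '' openCone y d ε ⊆
      openCone (e y) (e.toRealAffineIsometryEquiv.linearIsometryEquiv d) ε := by
  rintro _ ⟨x, hx, rfl⟩
  have h : e x - e y = e.toRealAffineIsometryEquiv.linearIsometryEquiv (x - y) := by
    have := e.toRealAffineIsometryEquiv.map_vsub x y
    simpa using this.symm
  simp only [openCone, mem_ofPred_eq] at hx ⊢
  rw [h, LinearIsometryEquiv.norm_map, LinearIsometryEquiv.inner_map_map]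
  exact hx

theorem isInvariantFamily_openCone (ε : ℝ) : PieceSystem.IsInvariantFamily
    {F : Filter Plane | ∃ y d, ‖d‖ = 1 ∧ F ≤ 𝓝[openCone y d ε] y} := by
  constructor
  · rintro F G hFG ⟨y, d, hd, h⟩
    exact ⟨y, d, hd, hFG.trans h⟩
  · rintro F ⟨y, d, hd, h⟩ e
    refine ⟨e y, e.toRealAffineIsometryEquiv.linearIsometryEquiv d, by simpa using hd,
      (map_mono h).trans ?_⟩
    exact (e.continuous.continuousWithinAt.tendsto_nhdsWithin_image).trans
      (nhdsWithin_mono _ (image_openCone_subset e y d ε))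

/-- A sufficiently narrow cone meets at most one of the two lines through its apex that are the
kernels of two given functionals. -/
theorem eventually_openCone_ker_le (φ ψ : Plane →ₗ[ℝ] ℝ) (hφ : φ ≠ 0) :
    ∀ᶠ ε in 𝓝[>] (0 : ℝ), ∀ y d : Plane, ‖d‖ = 1 → ∀ x ∈ openCone y d ε, ∀ z ∈ openCone y d ε,
      φ (x - y) = 0 → ψ (z - y) = 0 → ∀ u, φ u = 0 → ψ u = 0 := by
  by_cases hker : ∀ u, φ u = 0 → ψ u = 0
  · exact Eventually.of_forall fun _ _ _ _ _ _ _ _ _ _ => hker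
  have hφc : Continuous φ := φ.continuous_of_finiteDimensional
  have hψc : Continuous ψ := ψ.continuous_of_finiteDimensional
  -- The unit vectors in two distinct kernels form disjoint compact sets, so they have disjoint
  -- `ρ`-thickenings. A cone with `ε < ρ ^ 2 / 2` meeting both kernels would put `d` in both
  -- thickenings.
  have hA : IsCompact (Metric.sphere (0 : Plane) 1 ∩ {v | φ v = 0}) :=
    (isCompact_sphere _ _).inter_right (isClosed_eq hφc continuous_const)
  have hB : IsCompact (Metric.sphere (0 : Plane) 1 ∩ {v | ψ v = 0}) :=
    (isCompact_sphere _ _).inter_right (isClosed_eq hψc continuous_const)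
  have hdisj : Disjoint (Metric.sphere (0 : Plane) 1 ∩ {v | φ v = 0})
      (Metric.sphere (0 : Plane) 1 ∩ {v | ψ v = 0}) := by
    rw [Set.disjoint_left]
    rintro v ⟨hv1, hφv⟩ ⟨-, hψv⟩
    refine hker fun u hu => ?_
    have hv0 : v ≠ 0 := fun h => by simp [h] at hv1
    obtain ⟨c, rfl⟩ := exists_smul_eq_of_mem_ker hφ hv0 hφv hu
    rw [map_smul, show ψ v = 0 from hψv, smul_zero]
  obtain ⟨ρ, hρ, hth⟩ := hdisj.exists_thickenings hA hB.isClosed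
  have hmem : ∀ χ : Plane →ₗ[ℝ] ℝ, ∀ x y : Plane, x - y ≠ 0 → χ (x - y) = 0 →
      ‖x - y‖⁻¹ • (x - y) ∈ Metric.sphere (0 : Plane) 1 ∩ {v | χ v = 0} := by
    intro χ x y h0 hχ
    refine ⟨?_, ?_⟩
    · rw [mem_sphere_zero_iff_norm, norm_smul, norm_inv, norm_norm,
        inv_mul_cancel₀ (norm_ne_zero_iff.2 h0)]
    · simp only [mem_ofPred_eq, map_smul, hχ, smul_zero]
  filter_upwards [Ioo_mem_nhdsGT (show (0 : ℝ) < ρ ^ 2 / 2 by positivity)]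
  rintro ε ⟨-, hε⟩ y d hd x hx z hz hφx hψz
  exfalso
  refine Set.disjoint_left.1 hth (?_ : d ∈ _) ?_
  · exact Metric.mem_thickening_iff.2 ⟨_, hmem φ x y (ne_of_mem_openCone hx) hφx, by
      rw [dist_comm, dist_eq_norm]
      exact norm_normalize_sub_lt hd hρ (by linarith) hx⟩
  · exact Metric.mem_thickening_iff.2 ⟨_, hmem ψ z y (ne_of_mem_openCone hz) hψz, by
      rw [dist_comm, dist_eq_norm]
      exact norm_normalize_sub_lt hd hρ (by linarith) hz⟩

/-- The unit circle of directions at any point is covered by finitely many cones. -/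
theorem exists_finset_openCone_cover {ε : ℝ} (hε : 0 < ε) :
    ∃ t : Finset Plane, (∀ d ∈ t, ‖d‖ = 1) ∧
      ∀ x y : Plane, x ≠ y → ∃ d ∈ t, x ∈ openCone y d ε := by
  obtain ⟨t, ht, hcov⟩ := (isCompact_sphere (0 : Plane) 1).elim_nhds_subcover
    (fun d => openCone 0 d ε) fun d hd => (isOpen_openCone 0 d ε).mem_nhds (by
      have hd' : ‖d‖ = 1 := by simpa using hd
      simp [openCone, hd', hε])
  refine ⟨t, fun d hd => by simpa using ht d hd, fun x y hxy => ?_⟩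
  have h0 : 0 < ‖x - y‖ := norm_pos_iff.2 (sub_ne_zero.2 hxy)
  have h1 : ‖‖x - y‖⁻¹ • (x - y)‖ = 1 := by
    rw [norm_smul, norm_inv, norm_norm, inv_mul_cancel₀ h0.ne']
  obtain ⟨d, hd, hxd⟩ := mem_iUnion₂.1 (hcov (mem_sphere_zero_iff_norm.2 h1))
  refine ⟨d, hd, ?_⟩
  simp only [openCone, mem_ofPred_eq, sub_zero, h1, mul_one] at hxd ⊢
  rwa [real_inner_smul_left, inv_mul_eq_div, lt_div_iff₀ h0] at hxd

theorem exists_mem_apply_sub_ne_zero {V : Set Plane} (hV : IsOpen V) {x : Plane} (hx : x ∈ V)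
    {φ : Plane →ₗ[ℝ] ℝ} (hφ : φ ≠ 0) (y : Plane) : ∃ z ∈ V, φ (z - y) ≠ 0 := by
  by_contra! h
  obtain ⟨u, hu⟩ : ∃ u, φ u ≠ 0 := by
    by_contra! h0
    exact hφ (LinearMap.ext h0)
  have hc : Tendsto (fun t : ℝ => x + t • u) (𝓝[≠] 0) (𝓝 x) := by
    have : Continuous fun t : ℝ => x + t • u := by fun_prop
    have h1 := this.tendsto 0
    rw [zero_smul, add_zero] at h1
    exact h1.mono_left nhdsWithin_le_nhds
  obtain ⟨t, htV, ht0⟩ := ((hc.eventually (hV.mem_nhds hx)).and self_mem_nhdsWithin).exists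
  have h1 := h _ htV
  have h2 := h _ hx
  rw [add_sub_right_comm, map_add, h2, zero_add, map_smul, smul_eq_mul] at h1
  exact (mul_ne_zero ht0 hu) h1

/-! ### Local counts and subexponential growth -/

namespace PieceSystem

variable {ι : Type*} (S : PieceSystem ι) [Finite ι]

/-- A connected set missing the boundary of an open cylinder lies inside it or off its closure, and
cylinders of equal length are disjoint. -/
theorem card_words_le_one_of_isPreconnected {Q : Set Plane} (hQ : IsPreconnected Q) {K : ℕ}
    (hf : ∀ w : List ι, w.length = K → Disjoint Q (frontier (S.cyl w))) :
    (S.words K (𝓟 Q)).card ≤ 1 := by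
  refine Finset.card_le_one.2 fun u hu w hw => ?_
  obtain ⟨hul, hu⟩ := S.mem_words.1 hu
  obtain ⟨hwl, hw⟩ := S.mem_words.1 hw
  obtain ⟨x, hxQ, hxu⟩ := frequently_principal.1 hu
  obtain ⟨z, hzQ, hzw⟩ := frequently_principal.1 hw
  by_contra hne
  have hzu : z ∉ S.cyl u :=
    Set.disjoint_right.1 (S.disjoint_cyl (hul.trans hwl.symm) hne) hzw
  have hcover : Q ⊆ S.cyl u ∪ (closure (S.cyl u))ᶜ := by
    intro a ha
    by_contra h
    rw [mem_union, not_or, notMem_compl_iff] at h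
    refine Set.disjoint_left.1 (hf u hul) ha ?_
    rw [(S.isOpen_cyl u).frontier_eq]
    exact ⟨h.2, h.1⟩
  obtain ⟨a, -, ha, ha'⟩ := hQ _ _ (S.isOpen_cyl u) isClosed_closure.isOpen_compl hcover
    ⟨x, hxQ, hxu⟩ ⟨z, hzQ, (hcover hzQ).resolve_left hzu⟩
  exact ha' (subset_closure ha)

/-- Narrow cones meet at most two cylinders of a given length near the apex. -/
theorem exists_openCone_card_words_le_two (K : ℕ) :
    ∃ ε > 0, ∀ F : Filter Plane, (∃ y d, ‖d‖ = 1 ∧ F ≤ 𝓝[openCone y d ε] y) →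
      (S.words K F).card ≤ 2 := by
  classical
  obtain ⟨T, hT, hcov⟩ : CoveredByLines
      (⋃ w : (List.finite_length_eq ι K).toFinset, frontier (S.cyl w)) :=
    CoveredByLines.iUnion fun w => S.coveredByLines_frontier_cyl w
  have hev : ∀ᶠ ε in 𝓝[>] (0 : ℝ), ∀ f ∈ T, ∀ f' ∈ T, ∀ y d : Plane, ‖d‖ = 1 →
      ∀ x ∈ openCone y d ε, ∀ z ∈ openCone y d ε,
        f.linear (x - y) = 0 → f'.linear (z - y) = 0 → ∀ u, f.linear u = 0 → f'.linear u = 0 := by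
    simp only [Filter.eventually_all_finset]
    exact fun f hf f' _ => eventually_openCone_ker_le _ _ (hT f hf)
  obtain ⟨ε, hε, hε0, hε1⟩ := (hev.and (Ioo_mem_nhdsGT (zero_lt_one' ℝ))).exists
  refine ⟨ε, hε0, ?_⟩
  rintro F ⟨y, d, hd, hF⟩
  -- Within radius `r` of the apex, only lines through the apex matter.
  obtain ⟨r, hr, hball⟩ : ∃ r > 0, ∀ x ∈ Metric.ball y r, ∀ f ∈ T, f x = 0 → f y = 0 := by
    have : ∀ᶠ x in 𝓝 y, ∀ f ∈ T, f x = 0 → f y = 0 := by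
      rw [Filter.eventually_all_finset]
      intro f _
      by_cases hfy : f y = 0
      · exact Eventually.of_forall fun _ _ => hfy
      · filter_upwards [(f.continuous_of_finiteDimensional.tendsto y).eventually_ne hfy] with x hx h
        exact absurd h hx
    exact Metric.eventually_nhds_iff_ball.1 this
  -- One functional vanishes on every line through `y` where it meets the cone. If no line meets it,
  -- any non-zero functional would do.
  obtain ⟨φ, hφ, hφT⟩ : ∃ φ : Plane →ₗ[ℝ] ℝ, φ ≠ 0 ∧ ∀ f ∈ T, ∀ z ∈ openCone y d ε,
      f.linear (z - y) = 0 → φ (z - y) = 0 := by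
    by_cases h : ∃ f ∈ T, ∃ x ∈ openCone y d ε, f.linear (x - y) = 0
    · obtain ⟨f, hf, x, hx, hfx⟩ := h
      exact ⟨f.linear, hT f hf, fun f' hf' z hz hfz =>
        hε f' hf' f hf y d hd z hz x hx hfz hfx _ hfz⟩
    · refine ⟨(lineFunction 0 d).linear, lineFunction_linear_ne_zero _ fun h0 => ?_, ?_⟩
      · simp [h0] at hd
      · exact fun f hf z hz hfz => absurd ⟨f, hf, z, hz, hfz⟩ h
  let Q : ℝ → Set Plane := fun σ =>
    (openCone y d ε ∩ Metric.ball y r) ∩ {x | 0 < σ * φ (x - y)}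
  have hQ : ∀ σ, (S.words K (𝓟 (Q σ))).card ≤ 1 := by
    intro σ
    apply card_words_le_one_of_isPreconnected
    · refine (((convex_openCone y d hε1.le).inter (convex_ball y r)).inter ?_).isPreconnected
      have : {x : Plane | 0 < σ * φ (x - y)} = {x | σ * φ y < (σ • φ) x} := by
        ext x
        simp [mul_sub]
      rw [this]
      exact convex_halfSpace_gt (σ • φ).isLinear _
    · intro w hw
      rw [Set.disjoint_left]
      rintro x ⟨⟨hxc, hxb⟩, hx⟩ hxw
      obtain ⟨f, hf, hfx⟩ := hcov x (mem_iUnion.2 ⟨⟨w, by simpa using hw⟩, hxw⟩)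
      have hfy := hball x hxb f hf hfx
      have hlin : f.linear (x - y) = 0 := by
        have := f.linearMap_vsub x y
        simpa [hfx, hfy] using this
      have := hφT f hf x hxc hlin
      rw [mem_ofPred_eq, this, mul_zero] at hx
      exact lt_irrefl _ hx
  have hcard : ({1, -1} : Finset ℝ).card ≤ 2 := Finset.card_le_two
  refine le_trans (S.card_words_le_sum {1, -1} (fun σ => 𝓟 (Q σ)) (c := 1) ?_ fun σ _ => hQ σ)
    (by simpa using hcard)
  intro w hl hw
  have hw' := hw.filter_mono hF
  rw [frequently_nhdsWithin_iff] at hw'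
  obtain ⟨x, ⟨hxw, hxc⟩, hxb⟩ := (hw'.and_eventually (Metric.ball_mem_nhds y hr)).exists
  -- The point found may lie on the dividing line; as the cylinder is open, it can be moved into one
  -- of the halves.
  obtain ⟨z, ⟨⟨hzw, hzc⟩, hzb⟩, hz⟩ := exists_mem_apply_sub_ne_zero
    (((S.isOpen_cyl w).inter (isOpen_openCone y d ε)).inter Metric.isOpen_ball)
    ⟨⟨hxw, hxc⟩, hxb⟩ hφ y
  rcases lt_or_gt_of_ne hz with h | h
  · exact ⟨-1, by simp, frequently_principal.2 ⟨z, ⟨⟨hzc, hzb⟩, by simpa using h⟩, hzw⟩⟩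
  · exact ⟨1, by simp, frequently_principal.2 ⟨z, ⟨⟨hzc, hzb⟩, by simpa using h⟩, hzw⟩⟩

/-- The number of cylinders meeting at a point grows at most like `2 ^ (n / K)`, for every `K`. -/
theorem exists_card_words_nhds_le {K : ℕ} (hK : 0 < K) :
    ∃ D : ℕ, ∀ n y, (S.words n (𝓝 y)).card ≤ D * 2 ^ (n / K) := by
  obtain ⟨ε, hε, hw⟩ := S.exists_openCone_card_words_le_two K
  obtain ⟨B, hB⟩ := S.exists_card_words_le (isInvariantFamily_openCone ε) hK hw
  obtain ⟨t, ht1, ht⟩ := exists_finset_openCone_cover hε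
  refine ⟨t.card * B, fun n y => ?_⟩
  rw [mul_assoc]
  refine S.card_words_le_sum t (fun d => 𝓝[openCone y d ε] y) (fun w _ hw => ?_)
    fun d hd => hB n _ ⟨y, d, ht1 d hd, le_rfl⟩
  -- Cones omit their apex, so points of the cylinder other than `y` are needed; an open set has no
  -- isolated points.
  have h1 : y ∈ closure (S.cyl w ∩ {y}ᶜ) :=
    closure_minimal ((dense_compl_singleton y).open_subset_closure_inter (S.isOpen_cyl w))
      isClosed_closure (mem_closure_iff_frequently.2 hw)
  by_contra! hd
  have h2 : ∀ᶠ x in 𝓝 y, ∀ d ∈ t, x ∈ openCone y d ε → x ∉ S.cyl w := by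
    rw [Filter.eventually_all_finset]
    intro d hdt
    exact eventually_nhdsWithin_iff.1 (hd d hdt)
  obtain ⟨x, ⟨hxw, hxy⟩, hx⟩ := ((mem_closure_iff_frequently.1 h1).and_eventually h2).exists
  obtain ⟨d, hdt, hxd⟩ := ht x y hxy
  exact hx d hdt hxd hxw

theorem _root_.pow_div_le_exp {a δ : ℝ} {K : ℕ} (ha : 0 ≤ a) (hδ : 0 ≤ δ)
    (h : a ≤ Real.exp (δ * K)) (n : ℕ) : a ^ (n / K) ≤ Real.exp (δ * n) := by
  refine (pow_le_pow_left₀ ha h _).trans ?_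
  rw [← Real.exp_nat_mul, Real.exp_le_exp]
  have : ((n / K * K : ℕ) : ℝ) ≤ n := Nat.cast_le.2 (Nat.div_mul_le_self n K)
  push_cast at this
  nlinarith [mul_le_mul_of_nonneg_left this hδ]

/-- The number of non-empty cylinders grows subexponentially. -/
theorem eventually_card_words_le_exp {ε : ℝ} (hε : 0 < ε) :
    ∀ᶠ n : ℕ in atTop, ((S.words n ⊤).card : ℝ) ≤ Real.exp (ε * n) := by
  -- One third of the rate for each factor: `K` absorbs 2, then `N` absorbs `D`, which depends on
  -- `K`, and finally `n` absorbs `B`.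
  have hδ : 0 < ε / 3 := by positivity
  have hlarge : ∀ c : ℝ, ∀ᶠ n : ℕ in atTop, c ≤ Real.exp (ε / 3 * n) := fun c =>
    (Real.tendsto_exp_atTop.comp
      (tendsto_natCast_atTop_atTop.const_mul_atTop hδ)).eventually_ge_atTop c
  obtain ⟨K, hK2, hK⟩ := ((hlarge 2).and (eventually_gt_atTop 0)).exists
  obtain ⟨D, hD⟩ := S.exists_card_words_nhds_le hK
  obtain ⟨N, hND, hN⟩ := ((hlarge D).and (eventually_gt_atTop 0)).exists
  obtain ⟨B, hB⟩ := S.exists_card_words_top_le hN (hD N)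
  have hc : ((D * 2 ^ (N / K) : ℕ) : ℝ) ≤ Real.exp (2 * (ε / 3) * N) := by
    push_cast
    rw [two_mul, add_mul, Real.exp_add]
    exact mul_le_mul hND (pow_div_le_exp zero_le_two hδ.le hK2 N) (by positivity)
      (Real.exp_pos _).le
  filter_upwards [hlarge B] with n hn
  calc ((S.words n ⊤).card : ℝ) ≤ ((B * (D * 2 ^ (N / K)) ^ (n / N) : ℕ) : ℝ) :=
        Nat.cast_le.2 (hB n)
    _ = B * ((D * 2 ^ (N / K) : ℕ) : ℝ) ^ (n / N) := by push_cast; rfl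
    _ ≤ Real.exp (ε / 3 * n) * Real.exp (2 * (ε / 3) * n) :=
        mul_le_mul hn (pow_div_le_exp (Nat.cast_nonneg _) (by positivity) hc n) (by positivity)
          (Real.exp_pos _).le
    _ = Real.exp (ε * n) := by
        rw [← Real.exp_add]
        ring_nf

end PieceSystem

/-! ### Entropy of the exchange -/

namespace EuclideanPolygonExchange

variable (E : EuclideanPolygonExchange)

/-- On the interior of `U (w 0)` only the branch `π (w 0)` of the exchange is available, because the
interiors of the atoms are disjoint. -/
theorem cylinder_succ {m : ℕ} {U : Fin m → Set Plane} {π : Fin m → Fin E.r}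
    (hπ : ∀ j, U j ⊆ E.P (π j)) {n : ℕ} (w : Fin (n + 1) → Fin m) :
    E.cylinder U w =
      interior (U (w 0)) ∩ E.g (π (w 0)) ⁻¹' E.cylinder U fun k => w k.succ := by
  ext x
  simp only [cylinder, mem_iInter, mem_inter_iff, mem_preimage]
  rw [Fin.forall_fin_succ]
  simp only [Fin.val_zero, Function.iterate_zero, id_eq, Fin.val_succ, Function.iterate_succ_apply']
  refine and_congr_right fun hx => forall_congr' fun k => ?_
  have hxP : x ∈ interior (E.P (π (w 0))) := interior_mono (hπ _) hx
  constructor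
  · rintro ⟨i, hi, hgi⟩
    have : i = π (w 0) := by
      by_contra h
      exact Set.disjoint_left.1 (E.partition.disjoint_interior _ _ h) hi hxP
    rwa [this] at hgi
  · exact fun h => ⟨_, hxP, h⟩

/-- The piecewise isometric system on the interiors of the atoms of a refinement. -/
def pieceSystem {m : ℕ} {U : Fin m → Set Plane} (hU : IsPolygonalPartition E.X U)
    (π : Fin m → Fin E.r) : PieceSystem (Fin m) where
  piece j := interior (U j)
  move j := E.g (π j)
  isOpen _ := isOpen_interior
  isBounded j := (hU.isPolygon j).isCompact.isBounded.subset interior_subset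
  disjoint := hU.disjoint_interior
  coveredByLines j := (hU.isPolygon j).coveredByLines_frontier.mono frontier_interior_subset

theorem cyl_pieceSystem {m : ℕ} {U : Fin m → Set Plane} (hU : IsPolygonalPartition E.X U)
    {π : Fin m → Fin E.r} (hπ : ∀ j, U j ⊆ E.P (π j)) {n : ℕ} (w : Fin n → Fin m) :
    (E.pieceSystem hU π).cyl (List.ofFn w) = E.cylinder U w := by
  induction n with
  | zero => simp [cylinder, PieceSystem.cyl]
  | succ n ih =>
    rw [E.cylinder_succ hπ, List.ofFn_succ, PieceSystem.cyl, ih]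
    rfl

theorem encard_join_le {m : ℕ} {U : Fin m → Set Plane} (hU : IsPolygonalPartition E.X U)
    {π : Fin m → Fin E.r} (hπ : ∀ j, U j ⊆ E.P (π j)) (n : ℕ) :
    (E.join U n).encard ≤ ((E.pieceSystem hU π).words n ⊤).card := by
  have hsub : E.join U n ⊆ (fun w => closure ((E.pieceSystem hU π).cyl w)) ''
      ((E.pieceSystem hU π).words n ⊤ : Set (List (Fin m))) := by
    rintro _ ⟨w, ⟨x, hx⟩, rfl⟩
    rw [← E.cyl_pieceSystem hU hπ] at hx ⊢
    refine ⟨List.ofFn w, Finset.mem_coe.2 ((PieceSystem.mem_words _).2 ⟨by simp, ?_⟩), rfl⟩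
    exact frequently_top.2 ⟨x, hx⟩
  refine (encard_le_encard hsub).trans ((encard_image_le _ _).trans_eq ?_)
  rw [encard_coe_eq_coe_finsetCard]

theorem entropyRel_le_zero {m : ℕ} {U : Fin m → Set Plane} (hU : IsPolygonalPartition E.X U)
    (hr : Refines U E.P) : E.entropyRel U ≤ 0 := by
  choose π hπ using hr
  rw [← EReal.le_of_forall_lt_iff_le]
  intro ε hε
  have hε' : 0 < ε := EReal.coe_pos.1 hε
  refine limsup_le_of_le (by isBoundedDefault) ?_
  filter_upwards [(E.pieceSystem hU π).eventually_card_words_le_exp hε', eventually_gt_atTop 0]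
    with n hn hn0
  have h0 : (0 : EReal) < n := by exact_mod_cast hn0
  rw [EReal.div_le_iff_le_mul h0 (EReal.natCast_ne_top n)]
  have h1 : (((E.join U n).encard : ℕ∞) : ℝ≥0∞) ≤ ENNReal.ofReal (Real.exp (ε * n)) := by
    calc (((E.join U n).encard : ℕ∞) : ℝ≥0∞)
        ≤ ((((E.pieceSystem hU π).words n ⊤).card : ℕ∞) : ℝ≥0∞) :=
          ENat.toENNReal_le.2 (E.encard_join_le hU hπ n)
      _ = ENNReal.ofReal (((E.pieceSystem hU π).words n ⊤).card : ℝ) := by simp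
      _ ≤ _ := ENNReal.ofReal_le_ofReal hn
  refine (ENNReal.log_le_log h1).trans_eq ?_
  rw [ENNReal.log_ofReal_of_pos (Real.exp_pos _), Real.log_exp, mul_comm]
  rw [EReal.coe_mul]
  rfl

/-- The boundaries of the finitely many closed atoms are nowhere dense, so an open set has a point
off all of them. -/
theorem exists_inter_interior_nonempty {V : Set Plane} (hV : IsOpen V) (hne : V.Nonempty)
    (hVX : V ⊆ E.X) : ∃ i, (V ∩ interior (E.P i)).Nonempty := by
  have hcl : ∀ i, IsClosed (E.P i) := fun i => (E.partition.isPolygon i).isCompact.isClosed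
  have hd : Dense (⋂ i, (frontier (E.P i))ᶜ) :=
    dense_iInter_of_isOpen (fun i => isClosed_frontier.isOpen_compl)
      fun i => interior_eq_empty_iff_dense_compl.1 (interior_frontier (hcl i))
  obtain ⟨x, hxV, hx⟩ := hd.inter_open_nonempty V hV hne
  have hxX := hVX hxV
  rw [← E.partition.iUnion_eq] at hxX
  obtain ⟨i, hi⟩ := mem_iUnion.1 hxX
  refine ⟨i, x, hxV, ?_⟩
  by_contra h
  exact mem_iInter.1 hx i ⟨subset_closure hi, h⟩

/-- The points with well-defined orbit segments of any given length are dense. -/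
theorem exists_cylinder_inter_nonempty (n : ℕ) : ∀ V : Set Plane, IsOpen V → V.Nonempty →
    V ⊆ E.X → ∃ w : Fin n → Fin E.r, (E.cylinder E.P w ∩ V).Nonempty := by
  induction n with
  | zero => exact fun V _ hne _ => ⟨Fin.elim0, by simpa [cylinder] using hne⟩
  | succ n ih =>
    intro V hV hne hVX
    obtain ⟨i, hi⟩ := E.exists_inter_interior_nonempty hV hne hVX
    -- The induction is applied to the forward image, which is open and stays in `X` because the
    -- images of the atoms fill `X`.
    obtain ⟨w, _, hw, x, ⟨hxV, hx⟩, rfl⟩ := ih (E.g i '' (V ∩ interior (E.P i)))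
      ((E.g i).toHomeomorph.isOpenMap _ (hV.inter isOpen_interior)) (hi.image _) (by
        rw [← E.image_partition.iUnion_eq]
        exact (image_mono (inter_subset_right.trans interior_subset)).trans
          (subset_iUnion (fun i => E.g i '' E.P i) i))
    refine ⟨Fin.cons i w, x, ?_, hxV⟩
    rw [E.cylinder_succ (U := E.P) (π := id) fun _ => Subset.rfl]
    exact ⟨by simpa using hx, by simpa using hw⟩

/-- No join is empty, so every logarithm is non-negative; this gives the lower bound for the
supremum. -/
theorem zero_le_entropyRel : 0 ≤ E.entropyRel E.P := by
  refine le_limsup_of_le (by isBoundedDefault) fun b hb => ?_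
  obtain ⟨n, hn⟩ := hb.exists
  refine le_trans ?_ hn
  refine EReal.div_nonneg ?_ (by positivity)
  rw [← ENNReal.log_one]
  refine ENNReal.log_le_log ?_
  obtain ⟨w, hw⟩ := E.exists_cylinder_inter_nonempty n _ isOpen_interior
    E.isPolygon.interior_nonempty interior_subset
  have : (E.join E.P n).Nonempty := ⟨_, w, hw.left, rfl⟩
  rw [← ENat.toENNReal_one]
  exact ENat.toENNReal_le.2 (one_le_encard_iff_nonempty.2 this)

theorem topologicalEntropy_eq_zero : E.topologicalEntropy = 0 := by
  refine le_antisymm ?_ ?_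
  · exact iSup_le fun m => iSup_le fun U => iSup_le fun hU => iSup_le fun hr =>
      E.entropyRel_le_zero hU hr
  · refine E.zero_le_entropyRel.trans ?_
    refine le_iSup_of_le E.r (le_iSup_of_le E.P (le_iSup_of_le E.partition
      (le_iSup_of_le (fun j => ⟨j, Subset.rfl⟩) le_rfl)))

/-! ### Linear growth of the boundary length -/

/-- The union of the boundaries of the cylinders of length `n`. -/
def cylinderBoundary (n : ℕ) : Set Plane :=
  ⋃ w : Fin n → Fin E.r, frontier (E.cylinder E.P w)

theorem cylinderBoundary_succ_subset (n : ℕ) :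
    E.cylinderBoundary (n + 1) ⊆ (⋃ i, frontier (E.P i)) ∪
      ⋃ i, E.g i ⁻¹' (E.cylinderBoundary n ∩ E.g i '' E.P i) := by
  refine iUnion_subset fun w x hx => ?_
  rw [E.cylinder_succ (U := E.P) (π := id) fun _ => Subset.rfl] at hx
  rcases frontier_inter_subset _ _ hx with ⟨h, -⟩ | ⟨h, h'⟩
  · exact Or.inl (mem_iUnion.2 ⟨_, frontier_interior_subset h⟩)
  · refine Or.inr (mem_iUnion.2 ⟨w 0, ?_, mem_image_of_mem _ ?_⟩)
    · rw [← (E.g _).coe_toHomeomorph, ← (E.g _).toHomeomorph.preimage_frontier] at h'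
      exact mem_iUnion.2 ⟨_, h'⟩
    · have hcl := (E.partition.isPolygon (w 0)).isCompact.isClosed
      exact hcl.closure_subset_iff.2 interior_subset h

theorem hausdorffMeasure_frontier_lt_top {A : Set Plane} (hA : IsPolygon A) :
    μH[1] (frontier A) < ∞ :=
  hA.coveredByLines_frontier.hausdorffMeasure_lt_top
    (hA.isCompact.isBounded.subset hA.isCompact.isClosed.frontier_subset)

/-- The image atoms overlap only in their boundaries, so cutting `B` along them counts length twice
at most there. Restricting the measure to `B` gives additivity over the open interiors without
measurability of `B`. -/
theorem sum_hausdorffMeasure_inter_image_le (B : Set Plane) :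
    ∑ i, μH[1] (B ∩ E.g i '' E.P i) ≤ μH[1] B + ∑ i, μH[1] (frontier (E.g i '' E.P i)) := by
  have h1 : ∀ i, μH[1] (B ∩ E.g i '' E.P i) ≤
      (μH[1] : Measure Plane).restrict B (interior (E.g i '' E.P i)) +
        μH[1] (frontier (E.g i '' E.P i)) := by
    intro i
    rw [Measure.restrict_apply isOpen_interior.measurableSet]
    refine (measure_mono ?_).trans (measure_union_le _ _)
    rintro x ⟨hxB, hx⟩
    by_cases h : x ∈ interior (E.g i '' E.P i)
    · exact Or.inl ⟨h, hxB⟩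
    · exact Or.inr ⟨subset_closure hx, h⟩
  refine (Finset.sum_le_sum fun i _ => h1 i).trans ?_
  rw [Finset.sum_add_distrib]
  gcongr
  calc _ ≤ (μH[1] : Measure Plane).restrict B univ :=
        sum_measure_le_measure_univ (fun i _ => isOpen_interior.nullMeasurableSet)
          fun i _ j _ hij => (E.image_partition.disjoint_interior i j hij).aedisjoint
    _ = _ := by simp

/-- The length of the boundary of the joins of the defining partition grows at most linearly. -/
theorem exists_boundaryLength_join_le :
    ∃ C : ℝ≥0, ∀ n : ℕ, boundaryLength (E.join E.P n) ≤ (C : ℝ≥0∞) * (n : ℝ≥0∞) := by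
  set c : ℝ≥0∞ := ∑ i, μH[1] (frontier (E.P i)) + ∑ i, μH[1] (frontier (E.g i '' E.P i)) with hc
  have hfin : c ≠ ∞ := ENNReal.add_ne_top.2
    ⟨(ENNReal.sum_lt_top.2 fun i _ =>
        hausdorffMeasure_frontier_lt_top (E.partition.isPolygon i)).ne,
      (ENNReal.sum_lt_top.2 fun i _ =>
        hausdorffMeasure_frontier_lt_top (E.image_partition.isPolygon i)).ne⟩
  refine ⟨c.toNNReal, fun n => ?_⟩
  rw [ENNReal.coe_toNNReal hfin]
  have hB : ∀ n : ℕ, μH[1] (E.cylinderBoundary n) ≤ c * n := by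
    intro n
    induction n with
    -- The only cylinder of length 0 is the plane, whose boundary is empty.
    | zero => simp [cylinderBoundary, cylinder]
    | succ n ih =>
      calc μH[1] (E.cylinderBoundary (n + 1))
          ≤ ∑ i, μH[1] (frontier (E.P i)) +
              ∑ i, μH[1] (E.g i ⁻¹' (E.cylinderBoundary n ∩ E.g i '' E.P i)) :=
            (measure_mono (E.cylinderBoundary_succ_subset n)).trans
              ((measure_union_le _ _).trans
                (add_le_add (measure_iUnion_fintype_le _ _) (measure_iUnion_fintype_le _ _)))
        _ = ∑ i, μH[1] (frontier (E.P i)) +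
              ∑ i, μH[1] (E.cylinderBoundary n ∩ E.g i '' E.P i) := by
            simp only [IsometryEquiv.hausdorffMeasure_preimage]
        _ ≤ ∑ i, μH[1] (frontier (E.P i)) + (μH[1] (E.cylinderBoundary n) +
              ∑ i, μH[1] (frontier (E.g i '' E.P i))) := by
            gcongr
            exact E.sum_hausdorffMeasure_inter_image_le _
        _ = μH[1] (E.cylinderBoundary n) + c := by rw [hc]; ring
        _ ≤ c * n + c := by gcongr
        _ = c * (n + 1 : ℕ) := by push_cast; ring
  refine (measure_mono ?_).trans (hB n)
  refine iUnion₂_subset ?_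
  rintro _ ⟨w, -, rfl⟩
  exact frontier_closure_subset.trans
    (subset_iUnion (fun w : Fin n → Fin E.r => frontier (E.cylinder E.P w)) w)

end EuclideanPolygonExchange

theorem theorem7 (E : EuclideanPolygonExchange) :
    E.topologicalEntropy = 0 ∧
      ∃ C : ℝ≥0, ∀ n : ℕ, 1 ≤ n → boundaryLength (E.join E.P n) ≤ (C : ℝ≥0∞) * (n : ℝ≥0∞) := by
  obtain ⟨C, hC⟩ := E.exists_boundaryLength_join_le
  exact ⟨E.topologicalEntropy_eq_zero, C, fun n _ => hC n⟩
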